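/- Let $G$ be a finite multigraph (parallel edges allowed) with $n \ge 3$ vertices that is $2$-edge-connected, i.e. deleting at most one edge of $G$ always leaves a connected graph on the same vertex set. Let $M_G$ be the cycle matroid of $G$: its ground set is the edge set of $G$ and its bases are the edge sets of the spanning trees of $G$ (loops of $G$, if there are any, lie in no basis). Let $\operatorname{BG}(M_G)$ be the basis graph of $M_G$: the simple graph whose vertices are the bases of $M_G$, where two bases $B_1, B_2$ are adjacent if and only if $|B_1 \mathbin{\Delta} B_2| = 2$. Then every edge of $\operatorname{BG}(M_G)$ lies in at least $2^{n-3}$ different Hamiltonian cycles of $\operatorname{BG}(M_G)$, where a Hamiltonian cycle is a cycle of $\operatorname{BG}(M_G)$ through all its vertices and two Hamiltonian cycles are different if their edge sets are different. -/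

import Mathlib

open scoped Graph

namespace Graph

variable {α β : Type*}

/-- Two vertices are joined by a walk of the multigraph. -/
def Reachable (G : Graph α β) : α → α → Prop :=
  Relation.ReflTransGen G.Adj

/-- A multigraph is connected if it has a vertex and any two vertices are joined by a walk. -/
def IsConnected (G : Graph α β) : Prop :=
  V(G).Nonempty ∧ ∀ x ∈ V(G), ∀ y ∈ V(G), G.Reachable x y

/-- A multigraph is `k`-edge-connected if deleting fewer than `k` edges never disconnects it. -/
def IsEdgeConnected (G : Graph α β) (k : ℕ) : Prop :=
  ∀ F ⊆ E(G), F.encard < (k : ℕ∞) → (G.deleteEdges F).IsConnected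

/-- `C` is the edge set of a cycle of `G`: there are `m + 1 ≥ 1` distinct vertices and `m + 1`
distinct edges such that the `i`-th edge joins the `i`-th vertex to the cyclically next one
(addition in `Fin (m + 1)` is modulo `m + 1`). A loop is a cycle of length one and two parallel
edges form a cycle of length two. -/
def IsCycleEdgeSet (G : Graph α β) (C : Set β) : Prop :=
  ∃ (m : ℕ) (v : Fin (m + 1) → α) (c : Fin (m + 1) → β),
    Function.Injective v ∧ Function.Injective c ∧
      (∀ i, G.IsLink (c i) (v i) (v (i + 1))) ∧ C = Set.range c

/-- `F` is the edge set of a forest of `G`: a set of edges containing no cycle. -/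
def IsForest (G : Graph α β) (F : Set β) : Prop :=
  F ⊆ E(G) ∧ ∀ C ⊆ F, ¬ G.IsCycleEdgeSet C

lemma Reachable.symm {G : Graph α β} {x y : α} (h : G.Reachable x y) : G.Reachable y x := by
  induction h with
  | refl => exact .refl
  | tail _ hbc ih => exact .head hbc.symm ih

lemma exists_isCycleEdgeSet_of_reachable {G : Graph α β} {I : Set β} {e : β} {x y : α}
    (he : G.IsLink e x y) (heI : e ∉ I) (h : (G.restrict I).Reachable x y) :
    ∃ C ⊆ insert e I, G.IsCycleEdgeSet C := by
  classical
  let H : SimpleGraph α :=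
    { Adj := fun a b => a ≠ b ∧ (G.restrict I).Adj a b
      symm := ⟨fun a b h => ⟨h.1.symm, h.2.symm⟩⟩
      loopless := ⟨fun a h => h.1 rfl⟩ }
  have hH : H.Reachable x y := by
    rw [SimpleGraph.reachable_iff_reflTransGen]
    clear he
    induction h with
    | refl => exact .refl
    | @tail b c _ hbc ih =>
      by_cases hne : b = c
      · exact hne ▸ ih
      · exact ih.tail ⟨hne, hbc⟩
  obtain ⟨p, hp⟩ := hH.exists_isPath
  have hstep : ∀ i : ℕ, ∃ f : β, i < p.length →
      f ∈ I ∧ G.IsLink f (p.getVert i) (p.getVert (i + 1)) := by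
    intro i
    by_cases hi : i < p.length
    · obtain ⟨f, hf⟩ := (p.adj_getVert_succ hi).2
      exact ⟨f, fun _ => hf⟩
    · exact ⟨e, fun h => absurd h hi⟩
  choose f hf using hstep
  have hinj : ∀ i j, i ≤ p.length → j ≤ p.length → p.getVert i = p.getVert j → i = j :=
    fun i j hi hj hij => hp.getVert_injOn hi hj hij
  let c : Fin (p.length + 1) → β := fun i => if i.1 < p.length then f i else e
  refine ⟨Set.range c, ?_, p.length, fun i => p.getVert i, c, ?_, ?_, ?_, rfl⟩
  · rintro _ ⟨i, rfl⟩
    by_cases hi : i.1 < p.length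
    · simp only [c, hi, if_true]
      exact Or.inr (hf _ hi).1
    · simp only [c, hi, if_false]
      exact Or.inl rfl
  · intro i j hij
    exact Fin.ext (hinj _ _ (by omega) (by omega) hij)
  · intro i j hij
    simp only [c] at hij
    apply Fin.ext
    split_ifs at hij with hi hj hj
    · have h1 := (hf _ hi).2
      have h2 := (hf _ hj).2
      rw [hij] at h1
      rcases h1.eq_and_eq_or_eq_and_eq h2 with ⟨h3, _⟩ | ⟨h3, h4⟩
      · exact hinj _ _ hi.le hj.le h3
      · have := hinj _ _ hi.le hj h3
        have := hinj _ _ hi hj.le h4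
        omega
    · exact absurd (hij ▸ (hf _ hi).1) heI
    · exact absurd (hij ▸ (hf _ hj).1) heI
    · omega
  · intro i
    by_cases hi : i.1 < p.length
    · have : ((i + 1 : Fin (p.length + 1)) : ℕ) = i + 1 := by
        rw [Fin.val_add_one_of_lt]
        exact hi
      simp only [c, hi, if_true, this]
      exact (hf _ hi).2
    · have hi' : i = Fin.last p.length := Fin.ext (by simp; omega)
      subst hi'
      simpa [c] using he.symm

lemma reachable_of_isCycleEdgeSet {G : Graph α β} {I C : Set β} {e : β} {x y : α}
    (he : G.IsLink e x y) (hC : G.IsCycleEdgeSet C) (hCI : C ⊆ insert e I) (heC : e ∈ C) :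
    (G.restrict I).Reachable x y := by
  obtain ⟨m, v, c, -, hc, hl, rfl⟩ := hC
  obtain ⟨i, rfl⟩ := heC
  have key : ∀ j : ℕ, j ≤ m →
      (G.restrict I).Reachable (v (i + 1)) (v (i + 1 + Fin.ofNat (m + 1) j)) := by
    intro j
    induction j with
    | zero =>
      intro _
      have h0 : (Fin.ofNat (m + 1) 0 : Fin (m + 1)) = 0 := rfl
      rw [h0, add_zero]
      exact Relation.ReflTransGen.refl
    | succ j ih =>
      intro hj
      refine (ih (by omega)).tail ⟨c (i + 1 + Fin.ofNat (m + 1) j), ?_⟩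
      refine ⟨(hCI ⟨_, rfl⟩).resolve_left fun h => ?_, ?_⟩
      · have h1 := hc h
        rw [add_assoc] at h1
        have h2 : (1 + Fin.ofNat (m + 1) j : Fin (m + 1)) = 0 := by simpa using h1
        have h3 := congrArg Fin.val h2
        simp [Fin.val_add] at h3
        have h4 := Nat.le_of_dvd (by omega) (Nat.dvd_of_mod_eq_zero h3)
        omega
      · have := hl (i + 1 + Fin.ofNat (m + 1) j)
        have h2 : (Fin.ofNat (m + 1) (j + 1) : Fin (m + 1)) = Fin.ofNat (m + 1) j + 1 := by
          apply Fin.ext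
          simp [Fin.val_add]
        rw [h2, ← add_assoc]
        exact this
  have h := key m le_rfl
  have h2 : i + 1 + Fin.ofNat (m + 1) m = i := by
    have : (1 + Fin.ofNat (m + 1) m : Fin (m + 1)) = 0 := by
      apply Fin.ext
      simp [add_comm]
    rw [add_assoc, this, add_zero]
  rw [h2] at h
  rcases he.eq_and_eq_or_eq_and_eq (hl i) with ⟨rfl, rfl⟩ | ⟨rfl, rfl⟩
  · exact h.symm
  · exact h

lemma IsForest.insert_iff {G : Graph α β} {I : Set β} {e : β} {x y : α} (hI : G.IsForest I)
    (he : G.IsLink e x y) (heI : e ∉ I) :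
    G.IsForest (insert e I) ↔ ¬ (G.restrict I).Reachable x y := by
  constructor
  · intro h hr
    obtain ⟨C, hC, hC'⟩ := exists_isCycleEdgeSet_of_reachable he heI hr
    exact h.2 C hC hC'
  · intro h
    refine ⟨Set.insert_subset he.edge_mem hI.1, fun C hC hC' => ?_⟩
    by_cases heC : e ∈ C
    · exact h (reachable_of_isCycleEdgeSet he hC' hC heC)
    · exact hI.2 C (fun f hf => (hC hf).resolve_left fun h => heC (h ▸ hf)) hC'

lemma IsForest.subset {G : Graph α β} {I J : Set β} (hJ : G.IsForest J) (h : I ⊆ J) :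
    G.IsForest I :=
  ⟨h.trans hJ.1, fun C hC => hJ.2 C (hC.trans h)⟩

lemma IsForest.augment {G : Graph α β} {I B : Set β} (hI : G.IsForest I)
    (hnI : ¬ Maximal G.IsForest I) (hB : Maximal G.IsForest B) :
    ∃ e ∈ B \ I, G.IsForest (insert e I) := by
  by_contra! hcon
  have hBI : ∀ a b, (G.restrict B).Adj a b → (G.restrict I).Reachable a b := by
    rintro a b ⟨f, hfB, hf⟩
    by_cases hfI : f ∈ I
    · exact .single ⟨f, hfI, hf⟩
    · by_contra h
      exact hcon f ⟨hfB, hfI⟩ ((hI.insert_iff hf hfI).2 h)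
  have hEI : ∀ f a b, G.IsLink f a b → (G.restrict I).Reachable a b := by
    intro f a b hf
    have h1 : (G.restrict B).Reachable a b := by
      by_cases hfB : f ∈ B
      · exact .single ⟨f, hfB, hf⟩
      · by_contra h
        exact hfB (hB.2 ((hB.1.insert_iff hf hfB).2 h) (Set.subset_insert _ _) (Or.inl rfl))
    clear hf
    induction h1 with
    | refl => exact .refl
    | tail _ h ih => exact ih.trans (hBI _ _ h)
  refine hnI ⟨hI, fun J hJ hIJ f hfJ => ?_⟩
  by_contra hfI
  obtain ⟨a, b, hf⟩ := exists_isLink_of_mem_edgeSet (hJ.1 hfJ)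
  exact (hI.insert_iff hf hfI).1 (hJ.subset (Set.insert_subset hfJ hIJ)) (hEI f a b hf)

/-- The cycle matroid of `G`: the ground set is the edge set and the independent sets are the
edge sets of forests. If `G` is connected, its bases are the edge sets of the spanning trees. -/
def cycleMatroid (G : Graph α β) : Matroid β :=
  (IndepMatroid.ofFinitary E(G) G.IsForest
    ⟨Set.empty_subset _, by
      rintro C hC ⟨m, v, c, -, -, -, rfl⟩
      exact hC ⟨0, rfl⟩⟩
    (fun _ _ hJ h => hJ.subset h)
    (fun _ _ hI hnI hB => hI.augment hnI hB)
    (fun I hI => ⟨fun e he => (hI {e} (by simpa using he) (Set.finite_singleton e)).1 rfl, by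
      rintro C hC hcyc
      refine (hI C hC ?_).2 C subset_rfl hcyc
      obtain ⟨m, v, c, -, -, -, rfl⟩ := hcyc
      exact Set.finite_range c⟩)
    (fun _ hI => hI.1)).matroid

end Graph

/-- The basis graph of a matroid: the vertices are the bases, and two bases are adjacent when
their symmetric difference has exactly two elements. -/
def Matroid.basisGraph {β : Type*} (M : Matroid β) : SimpleGraph {B : Set β // M.IsBase B} where
  Adj B₁ B₂ := (symmDiff B₁.1 B₂.1).encard = 2
  symm := ⟨fun B₁ B₂ h => by rwa [symmDiff_comm]⟩
  loopless := ⟨fun B h => by simp at h⟩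

open Classical in
/-- The Hamiltonian cycles of a simple graph, each one identified with its set of edges, so that
neither a starting vertex nor a direction of traversal is recorded. -/
def SimpleGraph.hamiltonianCycles {V : Type*} (G : SimpleGraph V) : Set (Set (Sym2 V)) :=
  {C | ∃ (a : V) (p : G.Walk a a), p.IsHamiltonianCycle ∧ C = {e | e ∈ p.edges}}

/-- The number of different Hamiltonian cycles of the basis graph of `M` through a given edge. -/
noncomputable def Matroid.numHamiltonianCyclesThrough {β : Type*} (M : Matroid β)
    (e : Sym2 {B : Set β // M.IsBase B}) : ℕ :=
  {C ∈ M.basisGraph.hamiltonianCycles | e ∈ C}.ncard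

/-! The statement is proved for any finite basis family: two members `Z + x` and `Z + y` are joined
by at least `2 ^ (t - 1)` Hamiltonian paths, where `t` counts avoidable elements of `Z`
(`IsBasisFamily.hasManyHamPaths`). The proof is by induction on the number of members, splitting the
family at an element into the members containing it (contraction) and those avoiding it (deletion).

If some avoidable `e ∈ Z` is not doubly serial, every exchange between members containing `e` can be
rerouted through all members avoiding `e`. Inserting this detour at the first or the second step of
a path of the contraction doubles the number of paths. Otherwise the split is at `x`: if two
elements of `Z` are not in series with `x`, the members containing `x` can be left at two different
places, which doubles again; likewise for `y`. If neither applies, all avoidable elements of `Z` are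
in series with `x` and with `y`, so a single member avoids such an element, which double seriality
excludes.

For the graph, 2-edge-connectedness rules out coloops and connectedness gives rank at least `n - 1`.
So `Z` has at least `n - 2` elements, all avoidable, and the edge between the two bases closes each
path to a cycle. -/

/-- A finite family of sets with the basis exchange property and its dual form. -/
structure IsBasisFamily {β : Type*} (𝓑 : Set (Set β)) : Prop where
  finite : 𝓑.Finite
  exchange : ∀ {Z B : Set β} {a : β}, a ∉ Z → insert a Z ∈ 𝓑 → B ∈ 𝓑 → a ∉ B →
    ∃ b ∈ B, b ∉ Z ∧ insert b Z ∈ 𝓑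
  rev_exchange : ∀ {B₁ B₂ : Set β} {y : β}, B₁ ∈ 𝓑 → B₂ ∈ 𝓑 → y ∈ B₂ → y ∉ B₁ →
    ∃ x ∈ B₁, x ∉ B₂ ∧ insert y (B₁ \ {x}) ∈ 𝓑

namespace IsBasisFamily

variable {β : Type*} {𝓑 : Set (Set β)}

lemma eq_of_subset (h : IsBasisFamily 𝓑) {B B' : Set β} (hB : B ∈ 𝓑) (hB' : B' ∈ 𝓑)
    (hs : B ⊆ B') : B = B' := by
  by_contra hne
  obtain ⟨a, ha, haB⟩ : ∃ a ∈ B', a ∉ B := by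
    by_contra! hc
    exact hne (hs.antisymm hc)
  obtain ⟨b, hb, hbZ, -⟩ := h.exchange (Z := B' \ {a}) (a := a) (by simp)
    (by rwa [Set.insert_sdiff_singleton, Set.insert_eq_of_mem ha]) hB haB
  exact hbZ ⟨hs hb, fun hba => haB (hba ▸ hb)⟩

/-- This is contraction of `e`, with `e` kept in the members. An exchange never moves `e`, since
both sets involved contain it. -/
lemma sep_mem (h : IsBasisFamily 𝓑) (e : β) : IsBasisFamily {B ∈ 𝓑 | e ∈ B} where
  finite := h.finite.subset (Set.sep_subset _ _)
  exchange := by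
    rintro Z B a haZ ⟨h1, h2⟩ ⟨h3, h4⟩ haB
    obtain ⟨b, hb, hbZ, hb'⟩ := h.exchange haZ h1 h3 haB
    refine ⟨b, hb, hbZ, hb', Or.inr (h2.resolve_left ?_)⟩
    rintro rfl
    exact haB h4
  rev_exchange := by
    rintro B₁ B₂ y ⟨h1, h2⟩ ⟨h3, h4⟩ hy hy'
    obtain ⟨x, hx, hx', hb⟩ := h.rev_exchange h1 h3 hy hy'
    refine ⟨x, hx, hx', hb, Or.inr ⟨h2, ?_⟩⟩
    rintro rfl
    exact hx' h4

lemma sep_notMem (h : IsBasisFamily 𝓑) (e : β) : IsBasisFamily {B ∈ 𝓑 | e ∉ B} where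
  finite := h.finite.subset (Set.sep_subset _ _)
  exchange := by
    rintro Z B a haZ ⟨h1, h2⟩ ⟨h3, h4⟩ haB
    obtain ⟨b, hb, hbZ, hb'⟩ := h.exchange haZ h1 h3 haB
    refine ⟨b, hb, hbZ, hb', ?_⟩
    rintro (rfl | h5)
    · exact h4 hb
    · exact h2 (Or.inr h5)
  rev_exchange := by
    rintro B₁ B₂ y ⟨h1, h2⟩ ⟨h3, h4⟩ hy hy'
    obtain ⟨x, hx, hx', hb⟩ := h.rev_exchange h1 h3 hy hy'
    refine ⟨x, hx, hx', hb, ?_⟩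
    rintro (rfl | h5)
    · exact h4 hy
    · exact h2 h5.1

end IsBasisFamily

/-! ### Series pairs and local exchanges -/

/-- Every member of the family contains `p` or `q`. If both elements are avoided by some member,
this says that they are in series. -/
def InSeries {β : Type*} (𝓑 : Set (Set β)) (p q : β) : Prop :=
  ∀ B ∈ 𝓑, p ∈ B ∨ q ∈ B

/-- Some member of the family avoids `e`, that is, `e` is not a coloop. -/
def Avoidable {β : Type*} (𝓑 : Set (Set β)) (e : β) : Prop :=
  ∃ B ∈ 𝓑, e ∉ B

section Series

variable {β : Type*} {𝓑 : Set (Set β)}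

lemma InSeries.symm {p q : β} (h : InSeries 𝓑 p q) : InSeries 𝓑 q p :=
  fun B hB => (h B hB).symm

/-- A member missing `u` and `w` contains `v`. After exchanging `v` out, the single new element
would have to be both `u` and `w`. -/
lemma InSeries.trans (h : IsBasisFamily 𝓑) {u v w : β} (hv : Avoidable 𝓑 v) (huw : u ≠ w)
    (h1 : InSeries 𝓑 u v) (h2 : InSeries 𝓑 v w) : InSeries 𝓑 u w := by
  intro B hB
  by_contra! hc
  have hvB : v ∈ B := (h1 B hB).resolve_left hc.1
  obtain ⟨B', hB', hvB'⟩ := hv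
  obtain ⟨b, hb, hbZ, hb'⟩ := h.exchange (Z := B \ {v}) (a := v) (by simp)
    (by rwa [Set.insert_sdiff_singleton, Set.insert_eq_of_mem hvB]) hB' hvB'
  have hv' : v ∉ insert b (B \ {v}) := by
    rintro (rfl | h3)
    · exact hvB' hb
    · exact h3.2 rfl
  have hu : u = b := ((h1 _ hb').resolve_right hv').resolve_right fun h3 => hc.1 h3.1
  have hw : w = b := ((h2 _ hb').resolve_left hv').resolve_right fun h3 => hc.2 h3.1
  exact huw (hu.trans hw.symm)

/-- If `Z + y + e` is a member and no member `Z + y + f` has `f ≠ e, x`,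
then `e` and `x` are in series. -/
lemma IsBasisFamily.exists_or_inSeries (h : IsBasisFamily 𝓑) {Z : Set β} {e x y : β} (he : e ∉ Z)
    (hey : e ≠ y) (hye : insert e (insert y Z) ∈ 𝓑) :
    (∃ f, f ∉ Z ∧ f ≠ e ∧ f ≠ x ∧ f ≠ y ∧ insert f (insert y Z) ∈ 𝓑) ∨ InSeries 𝓑 e x := by
  by_contra! hc
  obtain ⟨h1, h2⟩ := hc
  simp only [InSeries, not_forall, not_or] at h2
  obtain ⟨B, hB, heB, hxB⟩ := h2
  obtain ⟨f, hf, hfZ, hf'⟩ := h.exchange (Z := insert y Z) (by simp [hey, he]) hye hB heB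
  simp only [Set.mem_insert_iff, not_or] at hfZ
  exact h1 f hfZ.2 (fun h => heB (h ▸ hf)) (fun h => hxB (h ▸ hf)) hfZ.1 hf'

/-- The two members `Z + x + e` and `Z + y + e` can be moved off `e`. -/
lemma IsBasisFamily.exists_common_or (h : IsBasisFamily 𝓑) {Z : Set β} {e x y : β} (he : e ∉ Z)
    (hx : x ∉ Z) (hy : y ∉ Z) (hex : e ≠ x) (hey : e ≠ y) (hxy : x ≠ y)
    (hxe : insert e (insert x Z) ∈ 𝓑) (hye : insert e (insert y Z) ∈ 𝓑)
    (hav : Avoidable 𝓑 e) :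
    (∃ f, f ∉ Z ∧ f ≠ e ∧ f ≠ x ∧ f ≠ y ∧
      insert f (insert x Z) ∈ 𝓑 ∧ insert f (insert y Z) ∈ 𝓑) ∨ insert x (insert y Z) ∈ 𝓑 := by
  by_contra! hc
  obtain ⟨h1, h2⟩ := hc
  obtain ⟨B, hB, heB⟩ := hav
  obtain ⟨f, hf, hfZ, hf'⟩ := h.exchange (Z := insert x Z) (by simp [hex, he]) hxe hB heB
  simp only [Set.mem_insert_iff, not_or] at hfZ
  have hfe : f ≠ e := fun h => heB (h ▸ hf)
  have hfy : f ≠ y := by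
    rintro rfl
    rw [Set.insert_comm] at hf'
    exact h2 hf'
  obtain ⟨g, hg, hg', hg''⟩ := h.rev_exchange (y := y) hf' hye (by simp)
    (by simp [hfy.symm, hxy.symm, hy])
  simp only [Set.mem_insert_iff, not_or] at hg hg'
  rcases hg with rfl | rfl | hg
  · refine h2 ?_
    convert hg'' using 1
    ext t; simp only [Set.mem_insert_iff, Set.mem_sdiff, Set.mem_singleton_iff]; grind
  · refine h1 f hfZ.2 hfe hfZ.1 hfy hf' ?_
    convert hg'' using 1
    ext t; simp only [Set.mem_insert_iff, Set.mem_sdiff, Set.mem_singleton_iff]; grind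
  · exact hg'.2.2 hg

end Series

/-! ### Hamiltonian paths as lists, and their surgery -/

/-- `B'` arises from `B` by exchanging one element. -/
def IsExchange {β : Type*} (B B' : Set β) : Prop :=
  ∃ (Z : Set β) (a b : β), a ≠ b ∧ a ∉ Z ∧ b ∉ Z ∧ B = insert a Z ∧ B' = insert b Z

/-- A list enumerating the members of `𝓑` without repetition, from `X` to `Y`, by exchanges. -/
structure IsHamPath {β : Type*} (𝓑 : Set (Set β)) (X Y : Set β) (l : List (Set β)) : Prop where
  nodup : l.Nodup
  isChain : l.IsChain IsExchange
  mem_iff : ∀ B, B ∈ l ↔ B ∈ 𝓑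
  head : l.head? = some X
  last : l.getLast? = some Y

/-- There are at least `k` Hamiltonian paths of `𝓑` from `X` to `Y`. -/
def HasHamPaths {β : Type*} (𝓑 : Set (Set β)) (X Y : Set β) (k : ℕ) : Prop :=
  ∃ S : Finset (List (Set β)), k ≤ S.card ∧ ∀ l ∈ S, IsHamPath 𝓑 X Y l

section Paths

variable {β : Type*} {𝓑 𝓐 𝓓 : Set (Set β)} {X Y U V : Set β} {l d : List (Set β)}

lemma IsExchange.symm (h : IsExchange X Y) : IsExchange Y X := by
  obtain ⟨Z, a, b, h1, h2, h3, h4, h5⟩ := h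
  exact ⟨Z, b, a, h1.symm, h3, h2, h5, h4⟩

lemma IsHamPath.append (hl : IsHamPath 𝓐 X U l) (hd : IsHamPath 𝓓 V Y d)
    (hUV : IsExchange U V) (hdisj : Disjoint 𝓐 𝓓) : IsHamPath (𝓐 ∪ 𝓓) X Y (l ++ d) where
  nodup := by
    refine List.nodup_append'.2 ⟨hl.nodup, hd.nodup, fun B h1 h2 => ?_⟩
    exact Set.disjoint_left.1 hdisj ((hl.mem_iff B).1 h1) ((hd.mem_iff B).1 h2)
  isChain := by
    refine List.isChain_append.2 ⟨hl.isChain, hd.isChain, fun x hx y hy => ?_⟩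
    rw [hl.last] at hx
    rw [hd.head] at hy
    cases hx
    cases hy
    exact hUV
  mem_iff B := by simp [hl.mem_iff, hd.mem_iff]
  head := by simp [List.head?_append, hl.head]
  last := by simp [List.getLast?_append, hd.last]

lemma IsHamPath.reverse (hl : IsHamPath 𝓑 X Y l) : IsHamPath 𝓑 Y X l.reverse where
  nodup := List.nodup_reverse.2 hl.nodup
  isChain := by
    rw [List.isChain_reverse]
    exact hl.isChain.imp fun _ _ h => h.symm
  mem_iff B := by simp [hl.mem_iff]
  head := by simp [hl.last]
  last := by simp [hl.head]

lemma isHamPath_singleton (B : Set β) : IsHamPath {B} B B [B] where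
  nodup := by simp
  isChain := by simp
  mem_iff := by simp
  head := rfl
  last := rfl

lemma HasHamPaths.symm {k : ℕ} (h : HasHamPaths 𝓑 X Y k) : HasHamPaths 𝓑 Y X k := by
  classical
  obtain ⟨S, hS, hp⟩ := h
  refine ⟨S.image List.reverse, ?_, ?_⟩
  · rwa [Finset.card_image_of_injective _ List.reverse_injective]
  · simp only [Finset.mem_image, forall_exists_index, and_imp]
    rintro _ l hl rfl
    exact (hp l hl).reverse

lemma HasHamPaths.mono {k m : ℕ} (h : HasHamPaths 𝓑 X Y k) (hm : m ≤ k) : HasHamPaths 𝓑 X Y m :=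
  h.imp fun _ hS => ⟨hm.trans hS.1, hS.2⟩

lemma HasHamPaths.exists {k : ℕ} (h : HasHamPaths 𝓑 X Y k) (hk : 0 < k) :
    ∃ l, IsHamPath 𝓑 X Y l := by
  obtain ⟨S, hS, hp⟩ := h
  obtain ⟨l, hl⟩ := Finset.card_pos.1 (hk.trans_le hS)
  exact ⟨l, hp l hl⟩

lemma IsHamPath.hasHamPaths (h : IsHamPath 𝓑 X Y l) : HasHamPaths 𝓑 X Y 1 :=
  ⟨{l}, by simp, by simpa using h⟩

lemma IsHamPath.take (hl : IsHamPath 𝓑 X Y l) {k : ℕ} (hk : k + 1 < l.length) :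
    IsHamPath {B | B ∈ l.take (k + 1)} X l[k] (l.take (k + 1)) where
  nodup := hl.nodup.sublist (List.take_sublist _ _)
  isChain := hl.isChain.take _
  mem_iff B := Iff.rfl
  head := by simp [List.head?_take, hl.head]
  last := by
    rw [List.getLast?_take]
    simp [List.getElem?_eq_getElem (show k < l.length by omega)]

lemma IsHamPath.drop (hl : IsHamPath 𝓑 X Y l) {k : ℕ} (hk : k < l.length) :
    IsHamPath {B | B ∈ l.drop k} l[k] Y (l.drop k) where
  nodup := hl.nodup.sublist (List.drop_sublist _ _)
  isChain := hl.isChain.drop _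
  mem_iff B := Iff.rfl
  head := by simp [List.head?_drop, hk]
  last := by rw [List.getLast?_drop]; simp [hk, hl.last]

lemma IsHamPath.insert (hl : IsHamPath 𝓐 X Y l) {k : ℕ} (hk : k + 1 < l.length)
    (hd : IsHamPath 𝓓 U V d) (hU : IsExchange l[k] U) (hV : IsExchange V l[k + 1])
    (hdisj : Disjoint 𝓐 𝓓) :
    IsHamPath (𝓐 ∪ 𝓓) X Y (l.take (k + 1) ++ d ++ l.drop (k + 1)) := by
  have hA : 𝓐 = {B | B ∈ l.take (k + 1)} ∪ {B | B ∈ l.drop (k + 1)} := by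
    ext B
    rw [← hl.mem_iff, Set.mem_union, Set.mem_ofPred_eq, Set.mem_ofPred_eq, ← List.mem_append,
      List.take_append_drop]
  have h1 := ((hl.take hk).append hd hU ?_).append (hl.drop hk) hV ?_
  · rwa [hA, Set.union_right_comm]
  · rw [hA] at hdisj
    exact hdisj.mono_left Set.subset_union_left
  · refine Set.disjoint_union_left.2 ⟨?_, ?_⟩
    · rw [Set.disjoint_left]
      exact fun B h1 h2 => List.disjoint_take_drop hl.nodup le_rfl h1 h2
    · rw [hA] at hdisj
      exact (hdisj.mono_left Set.subset_union_right).symm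

lemma sep_union_sep (𝓑 : Set (Set β)) (e : β) : {B ∈ 𝓑 | e ∈ B} ∪ {B ∈ 𝓑 | e ∉ B} = 𝓑 := by
  ext B
  by_cases h : e ∈ B <;> simp [h]

lemma disjoint_sep_sep (𝓑 : Set (Set β)) (e : β) :
    Disjoint {B ∈ 𝓑 | e ∈ B} {B ∈ 𝓑 | e ∉ B} :=
  Set.disjoint_left.2 fun _ h1 h2 => h2.2 h1.2

open Classical in
-- Filtering a composite path by membership of `e` recovers its part in the contraction, so
-- different parts give different composites.
lemma IsHamPath.filter_mem {e : β} (hl : IsHamPath {B ∈ 𝓑 | e ∈ B} X Y l) :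
    l.filter (e ∈ ·) = l :=
  List.filter_eq_self.2 fun B hB => by simpa using ((hl.mem_iff B).1 hB).2

open Classical in
lemma IsHamPath.filter_notMem {e : β} (hl : IsHamPath {B ∈ 𝓑 | e ∉ B} X Y l) :
    l.filter (e ∈ ·) = [] :=
  List.filter_eq_nil_iff.2 fun B hB => by simpa using ((hl.mem_iff B).1 hB).2

lemma IsHamPath.two_le_length (hl : IsHamPath 𝓑 X Y l) (h : X ≠ Y) : 2 ≤ l.length := by
  have h1 := hl.head
  have h2 := hl.last
  match l with
  | [] => simp at h1
  | [B] =>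
    simp at h1 h2
    exact absurd (h1.symm.trans h2) h
  | _ :: _ :: _ => simp

lemma IsHamPath.three_le_length (hl : IsHamPath 𝓑 X Y l) (h : X ≠ Y) {B : Set β} (hB : B ∈ 𝓑)
    (hX : B ≠ X) (hY : B ≠ Y) : 3 ≤ l.length := by
  have h0 := hl.two_le_length h
  have h1 := hl.head
  have h2 := hl.last
  have h3 := (hl.mem_iff B).2 hB
  match l with
  | [] | [_] => simp at h0
  | [C, D] =>
    simp at h1 h2 h3
    subst h1 h2
    exact absurd h3 (by simp [hX, hY])
  | _ :: _ :: _ :: _ => simp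

/-- If every exchange within the members containing `e` can be rerouted through all members
avoiding `e`, then each Hamiltonian path of the former extends, in two ways if it is not
a single step. -/
lemma HasHamPaths.reroute {e : β} {k : ℕ} (h : HasHamPaths {B ∈ 𝓑 | e ∈ B} X Y k) (hXY : X ≠ Y)
    (hext : ∀ P Q, P ∈ 𝓑 → e ∈ P → Q ∈ 𝓑 → e ∈ Q → IsExchange P Q → ∃ U V d,
      IsHamPath {B ∈ 𝓑 | e ∉ B} U V d ∧ IsExchange P U ∧ IsExchange V Q) :
    HasHamPaths 𝓑 X Y k ∧
      ((∃ B ∈ 𝓑, e ∈ B ∧ B ≠ X ∧ B ≠ Y) → HasHamPaths 𝓑 X Y (2 * k)) := by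
  classical
  choose! U V d hd hU hV using hext
  obtain ⟨S, hS, hp⟩ := h
  -- The detour goes between positions `i` and `i + 1`. The default `∅` plays no role, as `ins i l`
  -- is used only when `i + 1 < l.length`.
  let ins : ℕ → List (Set β) → List (Set β) := fun i l =>
    l.take (i + 1) ++ d (l[i]?.getD ∅) (l[i + 1]?.getD ∅) ++ l.drop (i + 1)
  have hstep : ∀ l ∈ S, ∀ i, i + 1 < l.length → ∃ P Q, l[i]?.getD ∅ = P ∧ l[i + 1]?.getD ∅ = Q ∧
      IsHamPath {B ∈ 𝓑 | e ∉ B} (U P Q) (V P Q) (d P Q) ∧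
      IsHamPath 𝓑 X Y (ins i l) ∧ (ins i l).filter (e ∈ ·) = l := by
    intro l hl i hi
    have hl' := hp l hl
    have h1 := (hl'.mem_iff l[i]).1 (List.getElem_mem _)
    have h2 := (hl'.mem_iff l[i + 1]).1 (List.getElem_mem _)
    have h3 : IsExchange l[i] l[i + 1] := List.isChain_iff_getElem.1 hl'.isChain i hi
    have e1 : l[i]?.getD ∅ = l[i] := by simp [List.getElem?_eq_getElem (show i < l.length by omega)]
    have e2 : l[i + 1]?.getD ∅ = l[i + 1] := by simp [List.getElem?_eq_getElem hi]
    have hd' := hd _ _ h1.1 h1.2 h2.1 h2.2 h3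
    refine ⟨_, _, e1, e2, hd', ?_, ?_⟩
    · have := hl'.insert hi hd' (hU _ _ h1.1 h1.2 h2.1 h2.2 h3) (hV _ _ h1.1 h1.2 h2.1 h2.2 h3)
        (disjoint_sep_sep 𝓑 e)
      rw [sep_union_sep] at this
      simpa only [ins, e1, e2] using this
    · simp only [ins, e1, e2, List.filter_append, hd'.filter_notMem, List.append_nil]
      rw [← List.filter_append, List.take_append_drop, hl'.filter_mem]
  have hcard : ∀ i, (∀ l ∈ S, i + 1 < l.length) → k ≤ (S.image (ins i)).card := by
    intro i hi
    rw [Finset.card_image_of_injOn]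
    · exact hS
    · intro l hl l' hl' hll
      obtain ⟨_, _, _, _, _, _, h1⟩ := hstep l hl i (hi l hl)
      obtain ⟨_, _, _, _, _, _, h2⟩ := hstep l' hl' i (hi l' hl')
      rw [← h1, ← h2]
      exact congrArg _ hll
  have hlen : ∀ l ∈ S, 0 + 1 < l.length := fun l hl => (hp l hl).two_le_length hXY
  refine ⟨⟨S.image (ins 0), hcard 0 hlen, ?_⟩, ?_⟩
  · simp only [Finset.mem_image, forall_exists_index, and_imp]
    rintro _ l hl rfl
    obtain ⟨_, _, _, _, _, h1, _⟩ := hstep l hl 0 (hlen l hl)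
    exact h1
  · rintro ⟨B, hB, heB, hBX, hBY⟩
    have hlen' : ∀ l ∈ S, 1 + 1 < l.length := fun l hl =>
      (hp l hl).three_le_length hXY ⟨hB, heB⟩ hBX hBY
    refine ⟨S.image (ins 0) ∪ S.image (ins 1), ?_, ?_⟩
    · rw [Finset.card_union_of_disjoint]
      · have := hcard 0 hlen
        have := hcard 1 hlen'
        omega
      · rw [Finset.disjoint_left]
        simp only [Finset.mem_image]
        -- The entry at position 1 tells the two kinds apart: it avoids `e` when the detour is
        -- inserted at the first step and contains `e` when it is inserted at the second.
        rintro _ ⟨l, hl, rfl⟩ ⟨l', hl', hll⟩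
        obtain ⟨P, Q, hP, hQ, hd1, -, -⟩ := hstep l hl 0 (hlen l hl)
        obtain ⟨P', Q', -, -, -, -, h1⟩ := hstep l' hl' 1 (hlen' l' hl')
        have hl0 := hlen l hl
        have hl1 := hlen' l' hl'
        have a0 : (ins 0 l)[1]? = some (U P Q) := by
          have := hd1.head
          simp only [ins, hP, hQ]
          rw [List.append_assoc, List.getElem?_append_right (by simp)]
          rw [List.length_take, min_eq_left (by omega), ← List.head?_eq_getElem?]
          simp [List.head?_append, this]
        have a1 : (ins 1 l')[1]? = l'[1]? := by
          simp only [ins]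
          rw [List.append_assoc, List.getElem?_append_left (by simp; omega), List.getElem?_take]
          simp
        rw [← hll, a1, List.getElem?_eq_getElem (by omega)] at a0
        have m1 := (hp l' hl').mem_iff l'[1] |>.1 (List.getElem_mem _)
        have m2 := (hd1.mem_iff (U P Q)).1 (List.mem_of_mem_head? hd1.head)
        rw [Option.some.injEq] at a0
        rw [a0] at m1
        exact m2.2 m1.2
    · intro l hl
      rcases Finset.mem_union.1 hl with h | h <;> obtain ⟨l', hl', rfl⟩ := Finset.mem_image.1 h
      · obtain ⟨_, _, _, _, _, h1, _⟩ := hstep l' hl' 0 (hlen l' hl')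
        exact h1
      · obtain ⟨_, _, _, _, _, h1, _⟩ := hstep l' hl' 1 (hlen' l' hl')
        exact h1

/-- Paths through the members containing `e`, ending at different places, followed by a path
through the members avoiding `e`. -/
lemma HasHamPaths.append_two {e : β} {k : ℕ} {X₁ X₂ U₁ U₂ : Set β} (hne : X₁ ≠ X₂)
    (h₁ : HasHamPaths {B ∈ 𝓑 | e ∈ B} X X₁ k) (h₂ : HasHamPaths {B ∈ 𝓑 | e ∈ B} X X₂ k)
    {d₁ d₂ : List (Set β)} (hd₁ : IsHamPath {B ∈ 𝓑 | e ∉ B} U₁ Y d₁)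
    (hd₂ : IsHamPath {B ∈ 𝓑 | e ∉ B} U₂ Y d₂) (he₁ : IsExchange X₁ U₁) (he₂ : IsExchange X₂ U₂) :
    HasHamPaths 𝓑 X Y (2 * k) := by
  classical
  -- The last entry containing `e` is the place where the path leaves the contraction; it separates
  -- the two families.
  have key : ∀ {X' U' : Set β} {d' : List (Set β)}, HasHamPaths {B ∈ 𝓑 | e ∈ B} X X' k →
      IsHamPath {B ∈ 𝓑 | e ∉ B} U' Y d' → IsExchange X' U' →
      ∃ S : Finset (List (Set β)), k ≤ S.card ∧ (∀ l ∈ S, IsHamPath 𝓑 X Y l) ∧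
        ∀ l ∈ S, (l.filter (e ∈ ·)).getLast? = some X' := by
    intro X' U' d' h hd he
    obtain ⟨S, hS, hp⟩ := h
    refine ⟨S.image (· ++ d'), ?_, ?_, ?_⟩
    · rwa [Finset.card_image_of_injective _ (List.append_left_injective d')]
    · simp only [Finset.mem_image, forall_exists_index, and_imp]
      rintro _ l hl rfl
      have := (hp l hl).append hd he (disjoint_sep_sep 𝓑 e)
      rwa [sep_union_sep] at this
    · simp only [Finset.mem_image, forall_exists_index, and_imp]
      rintro _ l hl rfl
      rw [List.filter_append, (hp l hl).filter_mem, hd.filter_notMem, List.append_nil]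
      exact (hp l hl).last
  obtain ⟨S₁, hS₁, hp₁, hl₁⟩ := key h₁ hd₁ he₁
  obtain ⟨S₂, hS₂, hp₂, hl₂⟩ := key h₂ hd₂ he₂
  refine ⟨S₁ ∪ S₂, ?_, fun l hl => (Finset.mem_union.1 hl).elim (hp₁ l) (hp₂ l)⟩
  rw [Finset.card_union_of_disjoint]
  · omega
  · rw [Finset.disjoint_left]
    intro l h1 h2
    have := (hl₁ l h1).symm.trans (hl₂ l h2)
    exact hne (Option.some.inj this)

/-- If any two members differ by an exchange, there is a Hamiltonian path between any two. -/
lemma exists_isHamPath_of_pairwise (hfin : 𝓑.Finite) (h : 𝓑.Pairwise IsExchange) (hX : X ∈ 𝓑)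
    (hY : Y ∈ 𝓑) (hXY : X ≠ Y) : ∃ l, IsHamPath 𝓑 X Y l := by
  classical
  let R := ((hfin.toFinset.erase X).erase Y).toList
  have hR : ∀ B, B ∈ R ↔ B ≠ Y ∧ B ≠ X ∧ B ∈ 𝓑 := by simp [R]
  have hnd : (X :: (R ++ [Y])).Nodup := by
    simp only [List.nodup_cons, List.mem_append, List.mem_singleton, not_or, List.nodup_append']
    refine ⟨⟨fun h => ((hR X).1 h).2.1 rfl, hXY⟩, Finset.nodup_toList _, by simp, ?_⟩
    simp [hR]
  have hm : ∀ B, B ∈ X :: (R ++ [Y]) ↔ B ∈ 𝓑 := by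
    intro B
    simp only [List.mem_cons, List.mem_append, List.not_mem_nil, or_false, hR]
    constructor
    · rintro (rfl | h | rfl)
      exacts [hX, h.2.2, hY]
    · tauto
  refine ⟨X :: (R ++ [Y]), hnd, ?_, hm, rfl, ?_⟩
  · refine List.Pairwise.isChain ?_
    exact List.Pairwise.imp_of_mem (fun ha hb hab => h ((hm _).1 ha) ((hm _).1 hb) hab) hnd
  · rw [← List.cons_append, List.getLast?_append]
    rfl

end Paths

/-! ### The induction by deletion and contraction -/

/-- Two members `Z + x` and `Z + y` of `𝓑` are joined by at least `2 ^ (t - 1)` Hamiltonian paths,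
where `t` counts elements of `Z` avoided by some member. -/
def HasManyHamPaths {β : Type*} (𝓑 : Set (Set β)) : Prop :=
  ∀ (Z : Set β) (x y : β) (T : Finset β), x ≠ y → x ∉ Z → y ∉ Z → insert x Z ∈ 𝓑 →
    insert y Z ∈ 𝓑 → (T : Set β) ⊆ Z → (∀ a ∈ T, Avoidable 𝓑 a) →
    HasHamPaths 𝓑 (insert x Z) (insert y Z) (2 ^ (T.card - 1))

/-- `e` is in series with two further elements, and not all members avoiding `e` coincide. -/
def IsDoublySerial {β : Type*} (𝓑 : Set (Set β)) (e : β) : Prop :=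
  (¬ ∃ B₀, {B ∈ 𝓑 | e ∉ B} = {B₀}) ∧ ∃ p q, p ≠ q ∧ p ≠ e ∧ q ≠ e ∧ Avoidable 𝓑 p ∧
    Avoidable 𝓑 q ∧ InSeries 𝓑 e p ∧ InSeries 𝓑 e q

section Main

variable {β : Type*} {𝓑 : Set (Set β)} {Z : Set β} {x y e a : β}

lemma HasManyHamPaths.exists_isHamPath (h : HasManyHamPaths 𝓑) (hxy : x ≠ y) (hx : x ∉ Z)
    (hy : y ∉ Z) (hX : insert x Z ∈ 𝓑) (hY : insert y Z ∈ 𝓑) :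
    ∃ l, IsHamPath 𝓑 (insert x Z) (insert y Z) l :=
  (h Z x y ∅ hxy hx hy hX hY (by simp) (by simp)).exists (by simp)

lemma exists_eq_insert {S : Set β} (h : e ∈ S) : ∃ Z, e ∉ Z ∧ S = insert e Z :=
  ⟨S \ {e}, by simp, by simp [Set.insert_eq_of_mem h]⟩

/-- With `P = Z + x + e` and `Q = Z + y + e`, a common replacement `f` of `e` gives adjacent members
avoiding `e`. Otherwise `Z + x + y` is a member and serves as one end, the other being `Z + y + f`
or `Z + x + f`. Both choices fail only if `e` is in series with `x` and `y`. -/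
lemma IsBasisFamily.exists_reroute (h : IsBasisFamily 𝓑)
    (hD : HasManyHamPaths {B ∈ 𝓑 | e ∉ B}) (hav : Avoidable 𝓑 e) (hser : ¬ IsDoublySerial 𝓑 e)
    {P Q : Set β} (hP : P ∈ 𝓑) (heP : e ∈ P) (hQ : Q ∈ 𝓑) (heQ : e ∈ Q) (hPQ : IsExchange P Q) :
    ∃ U V d, IsHamPath {B ∈ 𝓑 | e ∉ B} U V d ∧ IsExchange P U ∧ IsExchange V Q := by
  obtain ⟨Z', x, y, hxy, hx', hy', rfl, rfl⟩ := hPQ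
  have heZ' : e ∈ Z' := by
    rcases heP with rfl | h1
    · rcases heQ with h2 | h2
      exacts [absurd h2 hxy, h2]
    · exact h1
  obtain ⟨Z, heZ, rfl⟩ := exists_eq_insert heZ'
  simp only [Set.mem_insert_iff, not_or] at hx' hy'
  obtain ⟨hxe, hx⟩ := hx'
  obtain ⟨hye, hy⟩ := hy'
  rw [Set.insert_comm x, Set.insert_comm y] at *
  -- If only one member avoids `e`, the detour is that member alone, and it is adjacent to both `P`
  -- and `Q`.
  by_cases hsing : ∃ B₀, {B ∈ 𝓑 | e ∉ B} = {B₀}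
  · obtain ⟨B₀, hB₀⟩ := hsing
    have hmem : B₀ ∈ {B ∈ 𝓑 | e ∉ B} := by rw [hB₀]; rfl
    have key : ∀ {z}, z ≠ e → insert e (insert z Z) ∈ 𝓑 →
        IsExchange (insert e (insert z Z)) B₀ := by
      intro z hze hz
      have hez : e ∉ insert z Z := by simp [hze.symm, heZ]
      obtain ⟨f, hf, hfZ, hf'⟩ := h.exchange hez hz hmem.1 hmem.2
      have hfe : e ≠ f := by
        rintro rfl
        exact hmem.2 hf
      have : insert f (insert z Z) ∈ {B ∈ 𝓑 | e ∉ B} := ⟨hf', by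
        rintro (h1 | h1)
        exacts [hfe h1, hez h1]⟩
      rw [hB₀, Set.mem_singleton_iff] at this
      exact ⟨_, e, f, hfe, hez, hfZ, rfl, this.symm⟩
    refine ⟨B₀, B₀, [B₀], hB₀ ▸ isHamPath_singleton B₀, key hxe hP, (key hye hQ).symm⟩
  have hmk : ∀ {Z' : Set β} {u v}, u ≠ v → u ∉ Z' → v ∉ Z' → insert u Z' ∈ 𝓑 →
      insert v Z' ∈ 𝓑 → e ∉ Z' → u ≠ e → v ≠ e →
      ∃ d, IsHamPath {B ∈ 𝓑 | e ∉ B} (insert u Z') (insert v Z') d := by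
    intro Z' u v huv hu hv hu' hv' he hue hve
    exact hD.exists_isHamPath huv hu hv ⟨hu', by simp [he, hue.symm]⟩
      ⟨hv', by simp [he, hve.symm]⟩
  have hmv : ∀ {z f}, z ≠ e → f ∉ Z → f ≠ e → f ≠ z →
      IsExchange (insert e (insert z Z)) (insert f (insert z Z)) := fun hze hf hfe hfz =>
    ⟨_, _, _, hfe.symm, by simp [hze.symm, heZ], by simp [hf, hfz], rfl, rfl⟩
  rcases h.exists_common_or heZ hx hy (Ne.symm hxe) (Ne.symm hye) hxy hP hQ hav with
    ⟨f, hf, hfe, hfx, hfy, h1, h2⟩ | hxyZ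
  · rw [Set.insert_comm] at h1 h2
    obtain ⟨d, hd⟩ := hmk hxy (by simp [hx, hfx.symm]) (by simp [hy, hfy.symm]) h1 h2
      (by simp [heZ, hfe.symm]) hxe hye
    rw [Set.insert_comm, Set.insert_comm y] at hd
    exact ⟨_, _, d, hd, hmv hxe hf hfe hfx, (hmv hye hf hfe hfy).symm⟩
  have hxyZ' := hxyZ
  rw [Set.insert_comm] at hxyZ'
  rcases h.exists_or_inSeries (x := x) heZ (Ne.symm hye) hQ with
    ⟨f, hf, hfe, hfx, hfy, h1⟩ | hsx
  · obtain ⟨d, hd⟩ := hmk hfx.symm (by simp [hx, hxy]) (by simp [hf, hfy]) hxyZ h1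
      (by simp [heZ, Ne.symm hye]) hxe hfe
    refine ⟨_, _, d, hd, ?_, (hmv hye hf hfe hfy).symm⟩
    rw [Set.insert_comm x]
    exact hmv hxe hy hye hxy.symm
  rcases h.exists_or_inSeries (x := y) heZ (Ne.symm hxe) hP with
    ⟨f, hf, hfe, hfy, hfx, h1⟩ | hsy
  · obtain ⟨d, hd⟩ := hmk hfy (by simp [hf, hfx]) (by simp [hy, hxy.symm]) h1 hxyZ'
      (by simp [heZ, Ne.symm hxe]) hfe hye
    refine ⟨_, _, d, hd, hmv hxe hf hfe hfx, ?_⟩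
    rw [Set.insert_comm y]
    exact (hmv hye hx hxe hxy).symm
  · exact absurd ⟨hsing, x, y, hxy, hxe, hye, ⟨_, hQ, by simp [hx, hxy, hxe]⟩,
      ⟨_, hP, by simp [hy, hxy.symm, hye]⟩, hsx, hsy⟩ hser

/-- It gives a way to leave the members containing `x`: replace `a` by `g`, then exchange `x` out.
Either `g` also replaces `a` in `Z + a + y`, or `g = y` and `x` is exchanged for some `f` that
exists because `a` and `x` are not in series. -/
lemma IsBasisFamily.exists_detour (h : IsBasisFamily 𝓑)
    (hD : HasManyHamPaths {B ∈ 𝓑 | x ∉ B}) (ha : a ∉ Z) (hx : x ∉ Z) (hy : y ∉ Z)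
    (hax : a ≠ x) (hay : a ≠ y) (hxy : x ≠ y) (hX : insert a (insert x Z) ∈ 𝓑)
    (hY : insert a (insert y Z) ∈ 𝓑) (hav : Avoidable 𝓑 a) (hser : ¬ InSeries 𝓑 a x) :
    ∃ g U d, g ∉ Z ∧ g ≠ a ∧ g ≠ x ∧ insert g (insert x Z) ∈ 𝓑 ∧
      IsHamPath {B ∈ 𝓑 | x ∉ B} U (insert a (insert y Z)) d ∧
      IsExchange (insert g (insert x Z)) U := by
  have hmk : ∀ {f}, f ∉ Z → f ≠ a → f ≠ x → f ≠ y → insert f (insert y Z) ∈ 𝓑 →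
      ∃ d, IsHamPath {B ∈ 𝓑 | x ∉ B} (insert f (insert y Z)) (insert a (insert y Z)) d := by
    intro f hf hfa hfx hfy hfB
    exact hD.exists_isHamPath hfa (by simp [hf, hfy]) (by simp [ha, hay])
      ⟨hfB, by simp [hfx.symm, hxy, hx]⟩ ⟨hY, by simp [hax.symm, hxy, hx]⟩
  rcases h.exists_common_or ha hx hy hax hay hxy hX hY hav with
    ⟨f, hf, hfa, hfx, hfy, h1, h2⟩ | hxyZ
  · obtain ⟨d, hd⟩ := hmk hf hfa hfx hfy h2
    refine ⟨f, _, d, hf, hfa, hfx, h1, hd, ⟨insert f Z, x, y, hxy, by simp [hfx.symm, hx],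
      by simp [hfy.symm, hy], Set.insert_comm _ _ _, Set.insert_comm _ _ _⟩⟩
  · obtain ⟨f, hf, hfa, hfx, hfy, h1⟩ := (h.exists_or_inSeries ha hay hY).resolve_right hser
    obtain ⟨d, hd⟩ := hmk hf hfa hfx hfy h1
    rw [Set.insert_comm] at hxyZ
    exact ⟨y, _, d, hy, hay.symm, hxy.symm, hxyZ, hd, insert y Z, x, f, hfx.symm,
      by simp [hxy, hx], by simp [hf, hfy], Set.insert_comm _ _ _, rfl⟩

/-- Truncated subtraction makes this hold for `t ≤ 1` too; for `t ≥ 2` it is an equality. -/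
lemma two_pow_pred_le (t : ℕ) : 2 ^ (t - 1) ≤ 2 * 2 ^ (t - 1 - 1) := by
  rcases t with _ | _ | t <;> simp [pow_succ]; omega

/-- Bringing `e` into a member by reverse exchange adds no other element, so `a` stays out. -/
lemma Avoidable.sep_mem (h : IsBasisFamily 𝓑) {X : Set β} (hX : X ∈ 𝓑)
    (heX : e ∈ X) (hae : a ≠ e) (ha : Avoidable 𝓑 a) : Avoidable {B ∈ 𝓑 | e ∈ B} a := by
  obtain ⟨B, hB, haB⟩ := ha
  by_cases heB : e ∈ B
  · exact ⟨B, ⟨hB, heB⟩, haB⟩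
  · obtain ⟨c, -, -, hc'⟩ := h.rev_exchange hB hX heX heB
    exact ⟨_, ⟨hc', by simp⟩, by simp [hae, haB]⟩

lemma IsBasisFamily.hasHamPaths_of_not_isDoublySerial (h : IsBasisFamily 𝓑)
    (hA : HasManyHamPaths {B ∈ 𝓑 | e ∈ B}) (hD : HasManyHamPaths {B ∈ 𝓑 | e ∉ B})
    (hxy : x ≠ y) (hx : x ∉ Z) (hy : y ∉ Z) (hX : insert x Z ∈ 𝓑) (hY : insert y Z ∈ 𝓑)
    {T : Finset β} (hT : (T : Set β) ⊆ Z) (hTav : ∀ a ∈ T, Avoidable 𝓑 a) (he : e ∈ Z)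
    (hav : Avoidable 𝓑 e) (hser : ¬ IsDoublySerial 𝓑 e) :
    HasHamPaths 𝓑 (insert x Z) (insert y Z) (2 ^ (T.card - 1)) := by
  classical
  have hTav' : ∀ a ∈ T.erase e, Avoidable {B ∈ 𝓑 | e ∈ B} a := fun a ha =>
    (hTav a (Finset.mem_of_mem_erase ha)).sep_mem h hX (Or.inr he) (Finset.ne_of_mem_erase ha)
  have hA' := hA Z x y (T.erase e) hxy hx hy ⟨hX, Or.inr he⟩ ⟨hY, Or.inr he⟩
    (fun a ha => hT (Finset.mem_of_mem_erase ha)) hTav'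
  have hXY : insert x Z ≠ insert y Z := fun h1 =>
    (h1 ▸ Set.mem_insert x Z : x ∈ insert y Z).elim hxy hx
  obtain ⟨h1, h2⟩ := hA'.reroute hXY fun P Q hP heP hQ heQ =>
    h.exists_reroute hD hav hser hP heP hQ heQ
  have hcard : T.card - 1 ≤ (T.erase e).card := Finset.pred_card_le_card_erase
  -- If nothing is left of `T`, one path suffices. Otherwise a member that contains `e` and misses
  -- some `t` is a third vertex of the contraction, so there are two places for the detour.
  rcases (T.erase e).eq_empty_or_nonempty with h0 | ⟨t, ht⟩
  · refine h1.mono (Nat.pow_le_pow_right two_pos ?_)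
    rw [h0] at hcard
    simp at hcard
    omega
  · obtain ⟨B, ⟨hB, heB⟩, htB⟩ := hTav' t ht
    have htZ := hT (Finset.mem_of_mem_erase ht)
    refine (h2 ⟨B, hB, heB, ?_, ?_⟩).mono ((two_pow_pred_le _).trans
      (Nat.mul_le_mul_left 2 (Nat.pow_le_pow_right two_pos (Nat.sub_le_sub_right hcard 1))))
    · rintro rfl
      exact htB (Or.inr htZ)
    · rintro rfl
      exact htB (Or.inr htZ)

lemma IsBasisFamily.hasHamPaths_of_two_not_inSeries (h : IsBasisFamily 𝓑)
    (hA : HasManyHamPaths {B ∈ 𝓑 | x ∈ B}) (hD : HasManyHamPaths {B ∈ 𝓑 | x ∉ B})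
    (hxy : x ≠ y) (hx : x ∉ Z) (hy : y ∉ Z) (hX : insert x Z ∈ 𝓑) (hY : insert y Z ∈ 𝓑)
    {T : Finset β} (hT : (T : Set β) ⊆ Z) (hTav : ∀ a ∈ T, Avoidable 𝓑 a) {a₁ a₂ : β}
    (h12 : a₁ ≠ a₂) (h₁ : a₁ ∈ Z) (h₂ : a₂ ∈ Z) (hav₁ : Avoidable 𝓑 a₁) (hav₂ : Avoidable 𝓑 a₂)
    (hser₁ : ¬ InSeries 𝓑 a₁ x) (hser₂ : ¬ InSeries 𝓑 a₂ x) :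
    HasHamPaths 𝓑 (insert x Z) (insert y Z) (2 ^ (T.card - 1)) := by
  classical
  have key : ∀ a ∈ Z, Avoidable 𝓑 a → ¬ InSeries 𝓑 a x → ∃ X' U d,
      HasHamPaths {B ∈ 𝓑 | x ∈ B} (insert x Z) X' (2 ^ (T.card - 1 - 1)) ∧
      IsHamPath {B ∈ 𝓑 | x ∉ B} U (insert y Z) d ∧ IsExchange X' U ∧ a ∉ X' ∧
      ∀ b ∈ Z, b ≠ a → b ∈ X' := by
    intro a haZ hav hser
    obtain ⟨Z₀, ha, rfl⟩ := exists_eq_insert haZ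
    simp only [Set.mem_insert_iff, not_or] at hx hy
    rw [Set.insert_comm] at hX hY
    obtain ⟨g, U, d, hg, hga, hgx, hgB, hd, hU⟩ := h.exists_detour hD ha hx.2 hy.2
      (Ne.symm hx.1) (Ne.symm hy.1) hxy hX hY hav hser
    refine ⟨_, U, d, ?_, ?_, hU, by simp [hga.symm, Ne.symm hx.1, ha], ?_⟩
    · rw [Set.insert_comm x]
      refine (hA _ a g (T.erase a) hga.symm (by simp [Ne.symm hx.1, ha]) (by simp [hgx, hg])
        ⟨hX, by simp⟩ ⟨hgB, by simp⟩ ?_ ?_).mono ?_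
      · intro b hb
        have hb' := Finset.mem_erase.1 (Finset.mem_coe.1 hb)
        exact Or.inr ((hT hb'.2).resolve_left hb'.1)
      · intro b hb
        have hb' := Finset.mem_erase.1 hb
        have hbZ := (hT hb'.2).resolve_left hb'.1
        refine (hTav b hb'.2).sep_mem h hX (by simp) ?_
        rintro rfl
        exact hx.2 hbZ
      · exact Nat.pow_le_pow_right two_pos
          (Nat.sub_le_sub_right Finset.pred_card_le_card_erase 1)
    · rwa [Set.insert_comm]
    · intro b hb hba
      exact Or.inr (Or.inr (hb.resolve_left hba))
  obtain ⟨X₁, U₁, d₁, hp₁, hd₁, he₁, hn₁, -⟩ := key a₁ h₁ hav₁ hser₁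
  obtain ⟨X₂, U₂, d₂, hp₂, hd₂, he₂, -, hm₂⟩ := key a₂ h₂ hav₂ hser₂
  -- `X₁` lacks `a₁`, while `X₂` has lost only `a₂`.
  have hne : X₁ ≠ X₂ := by
    rintro rfl
    exact hn₁ (hm₂ a₁ h₁ h12)
  exact (hp₁.append_two hne hp₂ hd₁ hd₂ he₁ he₂).mono (two_pow_pred_le _)

/-- Every member is `Z` plus one element, so the basis graph is complete. -/
lemma IsBasisFamily.exists_isHamPath_of_forall_mem (h : IsBasisFamily 𝓑) (hxy : x ≠ y)
    (hx : x ∉ Z) (hX : insert x Z ∈ 𝓑) (hY : insert y Z ∈ 𝓑) (hZ : ∀ B ∈ 𝓑, Z ⊆ B) :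
    ∃ l, IsHamPath 𝓑 (insert x Z) (insert y Z) l := by
  have key : ∀ B ∈ 𝓑, ∃ b, b ∉ Z ∧ B = insert b Z := by
    intro B hB
    by_cases hxB : x ∈ B
    · exact ⟨x, hx, (h.eq_of_subset hX hB (Set.insert_subset hxB (hZ B hB))).symm⟩
    · obtain ⟨b, hb, hbZ, hb'⟩ := h.exchange hx hX hB hxB
      exact ⟨b, hbZ, (h.eq_of_subset hb' hB (Set.insert_subset hb (hZ B hB))).symm⟩
  refine exists_isHamPath_of_pairwise h.finite ?_ hX hY fun h1 =>
    (h1 ▸ Set.mem_insert x Z : x ∈ insert y Z).elim hxy hx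
  intro B hB B' hB' hne
  obtain ⟨b, hb, rfl⟩ := key B hB
  obtain ⟨b', hb', rfl⟩ := key B' hB'
  refine ⟨Z, b, b', ?_, hb, hb', rfl, rfl⟩
  rintro rfl
  exact hne rfl

/-- If every avoidable element of `Z` is doubly serial and at most one of them is not in series
with `x`, then all of them are. -/
lemma IsBasisFamily.inSeries_of_isDoublySerial (h : IsBasisFamily 𝓑)
    (hx : x ∉ Z) (hX : insert x Z ∈ 𝓑)
    (hbad : ∀ a ∈ Z, Avoidable 𝓑 a → IsDoublySerial 𝓑 a)
    (hone : ∀ a₁ ∈ Z, ∀ a₂ ∈ Z, Avoidable 𝓑 a₁ → Avoidable 𝓑 a₂ → a₁ ≠ a₂ →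
      ¬ InSeries 𝓑 a₁ x → InSeries 𝓑 a₂ x) :
    ∀ a ∈ Z, Avoidable 𝓑 a → InSeries 𝓑 a x := by
  intro z hz hav
  by_contra hzx
  obtain ⟨-, p, q, hpq, hpz, hqz, hpa, hqa, hsp, hsq⟩ := hbad z hz hav
  have hzx' : z ≠ x := by
    rintro rfl
    exact hx hz
  -- No series partner of `z` lies in `Z + x`: one in `Z` would be in series with `x` and pass this
  -- on to `z`. But the two partners are in series with each other, so `Z + x` contains one of them.
  have key : ∀ p, p ≠ z → Avoidable 𝓑 p → InSeries 𝓑 z p → p ∉ insert x Z := by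
    rintro p hpz hpa hsp (rfl | hpZ)
    · exact hzx hsp
    · exact hzx (hsp.trans h hpa hzx' (hone z hz p hpZ hav hpa hpz.symm hzx))
  rcases (hsp.symm.trans h hav hpq hsq) _ hX with h1 | h1
  · exact key p hpz hpa hsp h1
  · exact key q hqz hqa hsq h1

/-- All avoidable elements of `Z + x + y` are pairwise in series, so a member missing `a` contains
all the others. That set is itself a member, and no member properly contains another. -/
lemma IsBasisFamily.sep_notMem_eq_singleton (h : IsBasisFamily 𝓑) (hxy : x ≠ y)
    (hx : x ∉ Z) (hy : y ∉ Z) (hX : insert x Z ∈ 𝓑) (hY : insert y Z ∈ 𝓑)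
    (hsx : ∀ a ∈ Z, Avoidable 𝓑 a → InSeries 𝓑 a x)
    (hsy : ∀ a ∈ Z, Avoidable 𝓑 a → InSeries 𝓑 a y) (ha : a ∈ Z) (hav : Avoidable 𝓑 a) :
    ∃ B₀, {B ∈ 𝓑 | a ∉ B} = {B₀} := by
  obtain ⟨Z₀, haZ, rfl⟩ := exists_eq_insert ha
  have hxa : Avoidable 𝓑 x := ⟨_, hY, fun h1 => h1.elim hxy hx⟩
  simp only [Set.mem_insert_iff, not_or] at hx hy
  have key : ∀ B ∈ 𝓑, a ∉ B → insert y (insert x Z₀) ⊆ B := by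
    intro B hB haB
    rintro u (rfl | rfl | hu)
    · exact (hsy a ha hav B hB).resolve_left haB
    · exact (hsx a ha hav B hB).resolve_left haB
    · by_contra huB
      have hua : u ≠ a := by
        rintro rfl
        exact haZ hu
      have := (hsx u (Or.inr hu) ⟨B, hB, huB⟩).trans h hxa hua (hsx a ha hav).symm
      exact (this B hB).elim huB haB
  have hmem : insert y (insert x Z₀) ∈ 𝓑 := by
    obtain ⟨B, hB, haB⟩ := hav
    rw [Set.insert_comm] at hX
    have hax : a ∉ insert x Z₀ := by simp [Ne.symm hx.1, haZ]
    obtain ⟨b, hb, hbZ, hb'⟩ := h.exchange hax hX hB haB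
    have hab : a ∉ insert b (insert x Z₀) := by
      rintro (rfl | h1)
      exacts [haB hb, hax h1]
    have hy' := key _ hb' hab (Set.mem_insert y _)
    have : y = b := hy'.resolve_right (by simp [hxy.symm, hy.2])
    rwa [this]
  refine ⟨insert y (insert x Z₀), ?_⟩
  ext B
  constructor
  · rintro ⟨hB, haB⟩
    exact (h.eq_of_subset hmem hB (key B hB haB)).symm
  · rintro rfl
    exact ⟨hmem, by simp [Ne.symm hx.1, Ne.symm hy.1, haZ]⟩

/-- The induction applies to both halves because each split is at an element that one member
contains and another avoids. -/
theorem IsBasisFamily.hasManyHamPaths (h : IsBasisFamily 𝓑) : HasManyHamPaths 𝓑 := by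
  induction hn : 𝓑.ncard using Nat.strong_induction_on generalizing 𝓑 with
  | _ n ih =>
  subst hn
  intro Z x y T hxy hx hy hX hY hT hTav
  have hA : ∀ {e B}, B ∈ 𝓑 → e ∉ B → HasManyHamPaths {B ∈ 𝓑 | e ∈ B} := fun {e B} hB heB =>
    ih _ (Set.ncard_lt_ncard ((Set.sep_subset _ _).ssubset_of_mem_notMem hB
      fun h1 => heB h1.2) h.finite) (h.sep_mem e) rfl
  have hD : ∀ {e B}, B ∈ 𝓑 → e ∈ B → HasManyHamPaths {B ∈ 𝓑 | e ∉ B} := fun {e B} hB heB =>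
    ih _ (Set.ncard_lt_ncard ((Set.sep_subset _ _).ssubset_of_mem_notMem hB
      fun h1 => absurd heB h1.2) h.finite)
      (h.sep_notMem e) rfl
  by_cases hZ : ∃ a ∈ Z, Avoidable 𝓑 a
  swap
  · push Not at hZ
    obtain ⟨l, hl⟩ := h.exists_isHamPath_of_forall_mem hxy hx hX hY fun B hB a ha => by
      by_contra haB
      exact hZ a ha ⟨B, hB, haB⟩
    have : T = ∅ := Finset.eq_empty_of_forall_notMem fun a ha => hZ a (hT ha) (hTav a ha)
    simpa [this] using hl.hasHamPaths
  by_cases hbad : ∀ a ∈ Z, Avoidable 𝓑 a → IsDoublySerial 𝓑 a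
  swap
  · push Not at hbad
    obtain ⟨e, he, hav, hser⟩ := hbad
    have hav' := hav
    obtain ⟨B, hB, heB⟩ := hav'
    exact h.hasHamPaths_of_not_isDoublySerial (hA hB heB) (hD hX (Or.inr he)) hxy hx hy hX hY hT
      hTav he hav hser
  have hxY : x ∉ insert y Z := fun h1 => h1.elim hxy hx
  have hyX : y ∉ insert x Z := fun h1 => h1.elim hxy.symm hy
  by_cases hone : ∀ a₁ ∈ Z, ∀ a₂ ∈ Z, Avoidable 𝓑 a₁ → Avoidable 𝓑 a₂ → a₁ ≠ a₂ →
      ¬ InSeries 𝓑 a₁ x → InSeries 𝓑 a₂ x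
  swap
  · push Not at hone
    obtain ⟨a₁, h₁, a₂, h₂, hav₁, hav₂, h12, hs₁, hs₂⟩ := hone
    exact h.hasHamPaths_of_two_not_inSeries (hA hY hxY) (hD hX (Or.inl rfl)) hxy hx hy hX hY hT
      hTav h12 h₁ h₂ hav₁ hav₂ hs₁ hs₂
  by_cases hone' : ∀ a₁ ∈ Z, ∀ a₂ ∈ Z, Avoidable 𝓑 a₁ → Avoidable 𝓑 a₂ → a₁ ≠ a₂ →
      ¬ InSeries 𝓑 a₁ y → InSeries 𝓑 a₂ y
  swap
  · push Not at hone'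
    obtain ⟨a₁, h₁, a₂, h₂, hav₁, hav₂, h12, hs₁, hs₂⟩ := hone'
    exact (h.hasHamPaths_of_two_not_inSeries (hA hX hyX) (hD hY (Or.inl rfl)) hxy.symm hy hx hY hX
      hT hTav h12 h₁ h₂ hav₁ hav₂ hs₁ hs₂).symm
  obtain ⟨a, ha, hav⟩ := hZ
  exact absurd (h.sep_notMem_eq_singleton hxy hx hy hX hY
    (h.inSeries_of_isDoublySerial hx hX hbad hone)
    (h.inSeries_of_isDoublySerial hy hY hbad hone') ha hav) (hbad a ha hav).1

end Main

/-! ### From Hamiltonian paths to Hamiltonian cycles -/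

namespace SimpleGraph.Walk

variable {V : Type*} {G : SimpleGraph V} {u v w : V}

/-- The first edge is the only one at `u`, so the path can be read off step by step. This is needed
because cycles are counted by their edge sets. -/
lemma IsPath.eq_of_mem_edges_iff {p q : G.Walk u v} (hp : p.IsPath) (hq : q.IsPath)
    (h : ∀ e, e ∈ p.edges ↔ e ∈ q.edges) : p = q := by
  induction p with
  | nil => exact (isPath_iff_nil.1 hq).eq_nil.symm
  | @cons u w v huw p ih =>
    rw [cons_isPath_iff] at hp
    cases q with
    | nil => exact absurd p.end_mem_support hp.2
    | @cons _ w' _ huw' q =>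
      rw [cons_isPath_iff] at hq
      simp only [edges_cons, List.mem_cons] at h
      have hw : s(u, w) = s(u, w') := ((h _).1 (Or.inl rfl)).resolve_right fun h1 =>
        hq.2 (fst_mem_support_of_mem_edges _ h1)
      obtain rfl : w = w' := Sym2.congr_right.1 hw
      congr 1
      refine ih hp.1 hq.1 fun e => ⟨fun h1 => ((h e).1 (Or.inr h1)).resolve_left ?_,
        fun h1 => ((h e).2 (Or.inr h1)).resolve_left ?_⟩
      · rintro rfl
        exact hp.2 (fst_mem_support_of_mem_edges _ h1)
      · rintro rfl
        exact hq.2 (fst_mem_support_of_mem_edges _ h1)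

lemma exists_support_eq {l : List V} (hl : l.IsChain G.Adj) (hu : l.head? = some u)
    (hv : l.getLast? = some v) : ∃ p : G.Walk u v, p.support = l := by
  have hne : l ≠ [] := by
    rintro rfl
    simp at hu
  rw [List.head?_eq_some_head hne, Option.some.injEq] at hu
  rw [List.getLast?_eq_some_getLast hne, Option.some.injEq] at hv
  exact ⟨(ofSupport l hne hl).copy hu hv, by simp⟩

lemma IsPath.notMem_edges_of_mem_support {p : G.Walk u v} (hp : p.IsPath)
    (hw : w ∈ p.support) (hwu : w ≠ u) (hwv : w ≠ v) : s(u, v) ∉ p.edges := by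
  cases p with
  | nil => simp
  | @cons _ x _ hux p =>
    rw [cons_isPath_iff] at hp
    simp only [edges_cons, List.mem_cons, not_or]
    refine ⟨fun h => ?_, fun h => hp.2 (fst_mem_support_of_mem_edges _ h)⟩
    obtain rfl : v = x := Sym2.congr_right.1 h
    rw [(isPath_iff_nil.1 hp.1).eq_nil] at hw
    simp [hwu, hwv] at hw

end SimpleGraph.Walk

open Classical in
/-- Closing Hamiltonian paths between two adjacent vertices gives different Hamiltonian cycles. -/
lemma SimpleGraph.le_ncard_hamiltonianCycles {V ι : Type*} [Finite V] {G : SimpleGraph V} {u v : V}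
    (huv : G.Adj u v) (hw : ∃ w, w ≠ u ∧ w ≠ v) (S : Finset ι) (p : ι → G.Walk u v)
    (hp : ∀ i ∈ S, (p i).IsPath ∧ ∀ w, w ∈ (p i).support) (hinj : Set.InjOn p S) :
    S.card ≤ {C ∈ G.hamiltonianCycles | s(u, v) ∈ C}.ncard := by
  obtain ⟨w, hwu, hwv⟩ := hw
  have hnot : ∀ i ∈ S, s(u, v) ∉ (p i).edges := fun i hi =>
    (hp i hi).1.notMem_edges_of_mem_support ((hp i hi).2 w) hwu hwv
  let F : ι → Set (Sym2 V) := fun i => {e | e ∈ (Walk.cons huv.symm (p i)).edges}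
  -- Removing `s(u, v)` from the cycle gives back the edge set of the path, which does not contain
  -- it.
  have hF : Set.InjOn F S := by
    intro i hi j hj hij
    refine hinj hi hj ((hp i hi).1.eq_of_mem_edges_iff (hp j hj).1 fun e => ?_)
    have h1 : e ∈ F i ↔ e ∈ F j := by rw [hij]
    simp only [F, Set.mem_ofPred_eq, Walk.edges_cons, List.mem_cons, Sym2.eq_swap (a := v)] at h1
    constructor
    · intro h2
      refine (h1.1 (Or.inr h2)).resolve_left ?_
      rintro rfl
      exact hnot i hi h2
    · intro h2
      refine (h1.2 (Or.inr h2)).resolve_left ?_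
      rintro rfl
      exact hnot j hj h2
  rw [← Set.ncard_coe_finset, ← hF.ncard_image]
  refine Set.ncard_le_ncard ?_ (Set.toFinite _)
  rintro _ ⟨i, hi, rfl⟩
  refine ⟨⟨v, Walk.cons huv.symm (p i), ?_, rfl⟩, ?_⟩
  · rw [Walk.isHamiltonianCycle_isCycle_and_isHamiltonian_tail, Walk.cons_isCycle_iff]
    refine ⟨⟨(hp i hi).1, by rw [Sym2.eq_swap]; exact hnot i hi⟩, ?_⟩
    refine Walk.IsPath.isHamiltonian_of_mem ?_ ?_
    · simpa using (hp i hi).1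
    · simpa using (hp i hi).2
  · simp [F, Sym2.eq_swap]

/-! ### Bases of a finite matroid -/

namespace Matroid

variable {β : Type*} {M : Matroid β}

lemma isBasisFamily_isBase (hE : M.E.Finite) : IsBasisFamily {B | M.IsBase B} where
  finite := hE.finite_subsets.subset fun _ hB => IsBase.subset_ground hB
  exchange := by
    intro Z B a haZ hZ hB haB
    obtain ⟨b, hb, hb'⟩ := IsBase.exchange hZ hB ⟨Set.mem_insert a Z, haB⟩
    have : insert a Z \ {a} = Z := by simp [haZ]
    rw [this] at hb'
    exact ⟨b, hb.1, fun h => hb.2 (Or.inr h), hb'⟩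
  rev_exchange := by
    intro B₁ B₂ y h₁ h₂ hy hy'
    have hyE : y ∈ M.E := IsBase.subset_ground h₂ hy
    -- Reverse exchange is ordinary exchange between the complements, which are bases of the dual.
    obtain ⟨x, hx, hx'⟩ := (IsBase.compl_isBase_dual h₁).exchange (IsBase.compl_isBase_dual h₂)
      (e := y) ⟨⟨hyE, hy'⟩, fun h => h.2 hy⟩
    have hxB : x ∈ B₁ := by
      by_contra h
      exact hx.2 ⟨hx.1.1, h⟩
    have heq : insert y (B₁ \ {x}) = M.E \ insert x ((M.E \ B₁) \ {y}) := by
      ext t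
      have : t ∈ B₁ → t ∈ M.E := fun h => IsBase.subset_ground h₁ h
      simp only [Set.mem_insert_iff, Set.mem_sdiff, Set.mem_singleton_iff]
      grind
    exact ⟨x, hxB, hx.1.2, heq ▸ hx'.compl_isBase_of_dual⟩

lemma basisGraph_adj_of_isExchange {B B' : {B : Set β // M.IsBase B}}
    (h : IsExchange B.1 B'.1) : M.basisGraph.Adj B B' := by
  obtain ⟨Z, a, b, hab, ha, hb, hB, hB'⟩ := h
  change (symmDiff B.1 B'.1).encard = 2
  rw [hB, hB', ← Set.encard_pair hab]
  congr 1
  ext t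
  simp only [Set.mem_symmDiff, Set.mem_insert_iff, Set.mem_singleton_iff]
  grind

/-- The two differences of a pair of bases have equal size, so each is a single element. -/
lemma exists_eq_insert_of_basisGraph_adj {B B' : {B : Set β // M.IsBase B}}
    (h : M.basisGraph.Adj B B') : ∃ (Z : Set β) (a b : β), a ≠ b ∧ a ∉ Z ∧ b ∉ Z ∧
      B.1 = insert a Z ∧ B'.1 = insert b Z := by
  change (symmDiff B.1 B'.1).encard = 2 at h
  have h1 := B.2.encard_sdiff_comm B'.2
  rw [Set.symmDiff_def, Set.encard_union_eq disjoint_sdiff_sdiff, ← h1, ← two_mul] at h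
  have h2 : (B.1 \ B'.1).encard = 1 := by
    generalize (B.1 \ B'.1).encard = k at h
    induction k with
    | top => simp at h
    | coe k =>
      norm_cast at h ⊢
      omega
  obtain ⟨a, ha⟩ := Set.encard_eq_one.1 h2
  obtain ⟨b, hb⟩ := Set.encard_eq_one.1 (h1 ▸ h2)
  have ha' : a ∈ B.1 \ B'.1 := ha ▸ rfl
  have hb' : b ∈ B'.1 \ B.1 := hb ▸ rfl
  refine ⟨B.1 ∩ B'.1, a, b, ?_, fun h => ha'.2 h.2, fun h => hb'.2 h.1, ?_, ?_⟩
  · rintro rfl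
    exact ha'.2 hb'.1
  · rw [Set.insert_eq, ← ha, Set.sdiff_union_inter]
  · rw [Set.insert_eq, ← hb, Set.inter_comm, Set.sdiff_union_inter]

lemma exists_walk_of_isHamPath {B B' : {B : Set β // M.IsBase B}} {l : List (Set β)}
    (hl : IsHamPath {B | M.IsBase B} B.1 B'.1 l) : ∃ p : M.basisGraph.Walk B B', p.IsPath ∧
      (∀ w, w ∈ p.support) ∧ p.support.map Subtype.val = l := by
  obtain ⟨l, rfl⟩ : ∃ l' : List {B : Set β // M.IsBase B}, l'.map Subtype.val = l :=
    CanLift.prf l fun B hB => (hl.mem_iff B).1 hB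
  obtain ⟨hnd, hch, hmem, hhd, hlast⟩ := hl
  obtain ⟨p, hp⟩ := SimpleGraph.Walk.exists_support_eq (G := M.basisGraph) (u := B) (v := B')
    (List.isChain_of_isChain_map (R := M.basisGraph.Adj) Subtype.val
      (fun _ _ h => basisGraph_adj_of_isExchange h) hch)
    (by
      rw [List.head?_map, Option.map_eq_some_iff] at hhd
      obtain ⟨C, hC, hC'⟩ := hhd
      rw [hC, Subtype.ext hC'])
    (by
      rw [List.getLast?_map, Option.map_eq_some_iff] at hlast
      obtain ⟨C, hC, hC'⟩ := hlast
      rw [hC, Subtype.ext hC'])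
  refine ⟨p, (SimpleGraph.Walk.isPath_def p).2 (hp ▸ hnd.of_map _), fun w => ?_, by rw [hp]⟩
  rw [hp]
  obtain ⟨w', hw', h⟩ := List.mem_map.1 ((hmem w.1).2 w.2)
  rwa [← Subtype.ext h]

/-- In a finite matroid of rank at least `r ≥ 2` without coloops, every edge of the basis graph
lies in at least `2 ^ (r - 2)` Hamiltonian cycles. -/
theorem two_pow_le_numHamiltonianCyclesThrough (hE : M.E.Finite) (hcol : ∀ e, ¬ M.IsColoop e)
    {r : ℕ} (hr : 2 ≤ r) (hrank : ∀ B, M.IsBase B → r ≤ B.ncard) :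
    ∀ e ∈ M.basisGraph.edgeSet, 2 ^ (r - 2) ≤ M.numHamiltonianCyclesThrough e := by
  intro e he
  induction e with
  | h X Y =>
  rw [SimpleGraph.mem_edgeSet] at he
  have hfam := isBasisFamily_isBase hE
  have : Finite {B : Set β // M.IsBase B} := hfam.finite
  have hav : ∀ a, Avoidable {B | M.IsBase B} a := by
    intro a
    have := hcol a
    rw [isColoop_iff_forall_mem_isBase] at this
    push Not at this
    exact this
  obtain ⟨Z, x, y, hxy, hx, hy, hX, hY⟩ := exists_eq_insert_of_basisGraph_adj he
  have hZfin : Z.Finite := hE.subset ((Set.subset_insert x Z).trans (hX ▸ X.2.subset_ground))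
  have hZcard : r ≤ Z.ncard + 1 := by
    rw [← Set.ncard_insert_of_notMem hx hZfin, ← hX]
    exact hrank _ X.2
  -- Without coloops every element of `Z` counts, so `T` is all of `Z` and the exponent is `Z.ncard
  -- - 1 ≥ r - 2`.
  obtain ⟨S, hS, hp⟩ := hfam.hasManyHamPaths Z x y hZfin.toFinset hxy hx hy
    (by rw [← hX]; exact X.2) (by rw [← hY]; exact Y.2) (by simp) fun a _ => hav a
  rw [← hX, ← hY] at hp
  have hwalk : ∀ l, ∃ p : M.basisGraph.Walk X Y, l ∈ S → p.IsPath ∧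
      (∀ w, w ∈ p.support) ∧ p.support.map Subtype.val = l := by
    intro l
    by_cases hl : l ∈ S
    · obtain ⟨p, h⟩ := exists_walk_of_isHamPath (hp l hl)
      exact ⟨p, fun _ => h⟩
    · exact ⟨.cons he .nil, fun h => absurd h hl⟩
  choose p hp' using hwalk
  -- A base missing some `z ∈ Z` is a third vertex, as required for closing paths to cycles; `r ≥ 2`
  -- provides `z`.
  obtain ⟨z, hz⟩ : Z.Nonempty := by
    rw [Set.nonempty_iff_ne_empty]
    rintro rfl
    simp at hZcard
    omega
  obtain ⟨B, hB, hzB⟩ := hav z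
  refine le_trans ?_ (SimpleGraph.le_ncard_hamiltonianCycles he ⟨⟨B, hB⟩, ?_, ?_⟩ S p
    (fun l hl => ⟨(hp' l hl).1, (hp' l hl).2.1⟩) ?_)
  · refine le_trans (Nat.pow_le_pow_right two_pos ?_) hS
    rw [← Set.ncard_eq_toFinset_card Z hZfin]
    omega
  · rintro rfl
    exact hzB (show z ∈ B from (show B = _ from hX) ▸ Or.inr hz)
  · rintro rfl
    exact hzB (show z ∈ B from (show B = _ from hY) ▸ Or.inr hz)
  · intro l hl l' hl' h
    rw [← (hp' l hl).2.2, ← (hp' l' hl').2.2, h]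

end Matroid

/-! ### Rank and coloops of the cycle matroid -/

namespace Graph

variable {α β : Type*} {G : Graph α β}

lemma IsForest.reachable_of_forall_insert {I F : Set β} {x y : α} (hI : G.IsForest I)
    (hF : ∀ f ∈ F, f ∉ I → ¬ G.IsForest (insert f I)) (h : (G.restrict F).Reachable x y) :
    (G.restrict I).Reachable x y := by
  induction h with
  | refl => exact .refl
  | tail _ hbc ih =>
    refine ih.trans ?_
    obtain ⟨f, hfF, hf⟩ := hbc
    by_cases hfI : f ∈ I
    · exact .single ⟨f, hfI, hf⟩
    · by_contra hr
      exact hF f hfF hfI ((hI.insert_iff hf hfI).2 hr)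

/-- A maximal forest of `G - e` already joins the ends of `e`, whereas a coloop could be added to it
without creating a cycle. -/
lemma IsConnected.not_isColoop {e : β} (hG : (G.deleteEdges {e}).IsConnected) :
    ¬ G.cycleMatroid.IsColoop e := by
  intro he
  obtain ⟨x, y, hxy⟩ := exists_isLink_of_mem_edgeSet (show e ∈ E(G) from he.mem_ground)
  obtain ⟨I, hI⟩ := G.cycleMatroid.exists_isBasis (E(G) \ {e}) Set.sdiff_subset
  obtain ⟨B, hB, hIB⟩ := hI.indep.exists_isBase_superset
  have heI : e ∉ I := fun h => (hI.subset h).2 rfl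
  have hins : G.IsForest (insert e I) :=
    hB.indep.subset (Set.insert_subset (he.mem_of_isBase hB) hIB)
  have hforest : G.IsForest I := hI.indep
  refine (hforest.insert_iff hxy heI).1 hins (hforest.reachable_of_forall_insert
    (F := E(G) \ {e}) ?_ ?_)
  · intro f hf hfI hfor
    exact hfI (hI.mem_of_insert_indep hf hfor)
  · rw [restrict_edgeSet_sdiff_eq_deleteEdges]
    exact hG.2 x hxy.left_mem y hxy.right_mem

/-- A base connects all vertices, so the simple graph `K` underlying it is connected and has at
least `V(G).ncard - 1` edges; each comes from a different element of `B`. -/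
lemma IsConnected.le_ncard_add_one (hG : G.IsConnected) {B : Set β} (hfin : B.Finite)
    (hB : G.cycleMatroid.IsBase B) : V(G).ncard ≤ B.ncard + 1 := by
  have hreach : ∀ x ∈ V(G), ∀ y ∈ V(G), (G.restrict B).Reachable x y := by
    intro x hx y hy
    refine IsForest.reachable_of_forall_insert (F := E(G)) hB.indep ?_ ?_
    · intro f _ hfB hfor
      have := hB.eq_of_subset_indep hfor (Set.subset_insert f B)
      exact hfB (this ▸ Set.mem_insert f B)
    · simpa using hG.2 x hx y hy
  let K : SimpleGraph V(G) :=
    { Adj := fun a b => a ≠ b ∧ (G.restrict B).Adj a b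
      symm := ⟨fun a b h => ⟨h.1.symm, h.2.symm⟩⟩
      loopless := ⟨fun a h => h.1 rfl⟩ }
  have hK : ∀ {x y} (hx : x ∈ V(G)), (G.restrict B).Reachable x y →
      ∃ hy : y ∈ V(G), K.Reachable ⟨x, hx⟩ ⟨y, hy⟩ := by
    intro x y hx h
    induction h with
    | refl => exact ⟨hx, .rfl⟩
    | @tail b c _ hbc ih =>
      obtain ⟨hb, ih⟩ := ih
      have hc : c ∈ V(G) := hbc.right_mem
      refine ⟨hc, ?_⟩
      by_cases hne : b = c
      · subst hne
        exact ih
      · exact ih.trans (SimpleGraph.Adj.reachable ⟨fun h => hne (congrArg Subtype.val h), hbc⟩)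
  have hconn : K.Connected :=
    { preconnected := fun x y => (hK x.2 (hreach x x.2 y y.2)).2
      nonempty := hG.1.to_subtype }
  have hlink : ∀ e : K.edgeSet, ∃ f : B, ∀ a b, e.1 = s(a, b) → G.IsLink f.1 a.1 b.1 := by
    rintro ⟨e, he⟩
    induction e with
    | h a b =>
    obtain ⟨-, f, hf, hl⟩ := he
    refine ⟨⟨f, hf⟩, fun a' b' h => ?_⟩
    rcases Sym2.eq_iff.1 h with ⟨rfl, rfl⟩ | ⟨rfl, rfl⟩
    exacts [hl, hl.symm]
  choose g hg using hlink
  have hinj : Function.Injective g := by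
    rintro ⟨e, he⟩ ⟨e', he'⟩ h
    induction e with
    | h a b =>
    induction e' with
    | h a' b' =>
    have h1 := hg ⟨_, he⟩ a b rfl
    have h2 := hg ⟨_, he'⟩ a' b' rfl
    rw [h] at h1
    refine Subtype.ext (Sym2.eq_iff.2 ?_)
    rcases h1.eq_and_eq_or_eq_and_eq h2 with ⟨h3, h4⟩ | ⟨h3, h4⟩
    · exact Or.inl ⟨Subtype.ext h3, Subtype.ext h4⟩
    · exact Or.inr ⟨Subtype.ext h3, Subtype.ext h4⟩
  have : Finite B := hfin
  have h1 := hconn.card_vert_le_card_edgeSet_add_one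
  have h2 := Nat.card_le_card_of_injective g hinj
  rw [Nat.card_coe_set_eq] at h1 h2
  rw [Nat.card_coe_set_eq] at h2
  rw [Nat.card_coe_set_eq] at h1
  omega

end Graph

theorem mainTheorem1 {α β : Type*} (G : Graph α β) (hfin : E(G).Finite) (n : ℕ) (hn : 3 ≤ n)
    (hV : V(G).encard = (n : ℕ∞)) (hG : G.IsEdgeConnected 2) :
    ∀ e ∈ G.cycleMatroid.basisGraph.edgeSet,
      2 ^ (n - 3) ≤ G.cycleMatroid.numHamiltonianCyclesThrough e := by
  have hconn : G.IsConnected := by simpa using hG ∅ (Set.empty_subset _) (by simp)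
  have hcol : ∀ e, ¬ G.cycleMatroid.IsColoop e := by
    intro e he
    have heE : e ∈ E(G) := he.mem_ground
    exact (hG {e} (by simpa using heE) (by rw [Set.encard_singleton]; norm_num)).not_isColoop he
  have hncard : V(G).ncard = n := by rw [Set.ncard_def, hV, ENat.toNat_natCast]
  have hrank : ∀ B, G.cycleMatroid.IsBase B → n - 1 ≤ B.ncard := by
    intro B hB
    have := hconn.le_ncard_add_one (hfin.subset hB.subset_ground) hB
    omega
  have := Matroid.two_pow_le_numHamiltonianCyclesThrough hfin hcol (r := n - 1) (by omega) hrank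
  rwa [show n - 1 - 2 = n - 3 by omega] at this
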